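/- Theorem. Let $R$ be a real closed field extension of $\mathbb{R}$, let $\Lambda$ be a divisible (totally) ordered abelian group, and let $H=R[[\epsilon^\Lambda]]$ be the field of Hahn series over $R$ with value group $\Lambda$, ordered as a real closed field ($x\le y$ iff $y-x$ is a square in $H$; equivalently, a nonzero series is positive iff its leading coefficient, i.e. the coefficient of its smallest exponent, is positive). For a function $f\colon\Lambda\to R$ define $$L_f\colon H\to H,\qquad L_f\Big(\sum_{e\in\Lambda}c_e\epsilon^e\Big)=\sum_{e\in\Lambda}f(e)\,c_e\,\epsilon^e .$$ Let $k\in\mathbb{Z}_{\ge0}$. A map $L\colon H\to H$ is called $k$-positive if for every symmetric positive semidefinite $k\times k$ matrix $(a_{ij})$ over $H$ the matrix $(L(a_{ij}))$ is positive semidefinite (every map is $0$-positive). The function $f$ is called $k$-positive semidefinite if for all $x_1,\dots,x_k\in\Lambda$ the matrix $(f(x_i+x_j))_{i,j}$ is positive semidefinite, and $k$-positive definite if for all pairwise different $x_1,\dots,x_k\in\Lambda$ the matrix $(f(x_i+x_j))_{i,j}$ is positive definite. Then: (1) If $f$ is $k$-positive definite, and $\Lambda\neq\{0\}$ or $k\le1$,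 then $L_f$ is $k$-positive. (2) If $L_f$ is $k$-positive, then $f$ is $k$-positive semidefinite. -/

import Mathlib

open scoped Matrix

/-- A square matrix over an ordered commutative ring is positive semidefinite if it is symmetric
and `xᵀ A x ≥ 0` for every vector `x`. -/
def IsPosSemidefMatrix {n K : Type*} [Fintype n] [CommRing K] [LinearOrder K]
    (A : Matrix n n K) : Prop :=
  A.IsSymm ∧ ∀ x : n → K, 0 ≤ x ⬝ᵥ (A *ᵥ x)

/-- A square matrix over an ordered commutative ring is positive definite if it is symmetric
and `xᵀ A x > 0` for every nonzero vector `x`. -/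
def IsPosDefMatrix {n K : Type*} [Fintype n] [CommRing K] [LinearOrder K]
    (A : Matrix n n K) : Prop :=
  A.IsSymm ∧ ∀ x : n → K, x ≠ 0 → 0 < x ⬝ᵥ (A *ᵥ x)

/-- A map `L : K → K` is `k`-positive if applying it entrywise to a symmetric positive
semidefinite `k × k` matrix always gives a positive semidefinite matrix. Every map is
`0`-positive. -/
def IsKPositive {K : Type*} [CommRing K] [LinearOrder K] (k : ℕ) (L : K → K) : Prop :=
  ∀ A : Matrix (Fin k) (Fin k) K, IsPosSemidefMatrix A → IsPosSemidefMatrix (A.map L)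

/-- `f : Λ → R` is `k`-positive semidefinite if `(f (xᵢ + xⱼ))` is a positive semidefinite matrix
for all `x₁, …, x_k`. -/
def IsKPosSemidefFun {Λ R : Type*} [Add Λ] [CommRing R] [LinearOrder R]
    (k : ℕ) (f : Λ → R) : Prop :=
  ∀ x : Fin k → Λ, IsPosSemidefMatrix (Matrix.of fun i j => f (x i + x j))

/-- `f : Λ → R` is `k`-positive definite if `(f (xᵢ + xⱼ))` is a positive definite matrix
for all pairwise different `x₁, …, x_k`. -/
def IsKPosDefFun {Λ R : Type*} [Add Λ] [CommRing R] [LinearOrder R]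
    (k : ℕ) (f : Λ → R) : Prop :=
  ∀ x : Fin k → Λ, Function.Injective x →
    IsPosDefMatrix (Matrix.of fun i j => f (x i + x j))

/-- The Hahn series field `R[[ε^Λ]]`, with the order in which a nonzero series is positive iff its
leading coefficient is positive; for real closed `R` and divisible `Λ` this is the only field
order, see `HahnField.le_iff_exists_sq_add`. -/
abbrev HahnField (Λ R : Type*) [LinearOrder Λ] [Zero R] : Type _ := Lex (HahnSeries Λ R)

/-- The map `L_f`, sending `∑ c_e ε^e` to `∑ f(e) c_e ε^e`. -/
def hahnMultiplier {Λ R : Type*} [LinearOrder Λ] [CommRing R] (f : Λ → R)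
    (a : HahnField Λ R) : HahnField Λ R :=
  toLex
    { coeff := fun e => f e * (ofLex a).coeff e
      isPWO_support' := (ofLex a).isPWO_support.mono (by
        intro e he h
        exact he (by simp [h])) }

/-- The order of `R[[ε^Λ]]` is the one of a real closed field: `a ≤ b` iff `b - a` is a square. -/
theorem HahnField.le_iff_exists_sq_add {Λ R : Type*}
    [AddCommGroup Λ] [LinearOrder Λ] [IsOrderedAddMonoid Λ] [DivisibleBy Λ ℕ]
    [Field R] [LinearOrder R] [IsStrictOrderedRing R] [IsRealClosed R]
    (a b : HahnField Λ R) : a ≤ b ↔ ∃ z : HahnField Λ R, z ^ 2 + a = b := by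
  constructor
  · intro hab
    suffices h : ∃ z : HahnSeries Λ R, z * z = ofLex b - ofLex a by
      obtain ⟨z, hz⟩ := h
      refine ⟨toLex z, ?_⟩
      have hz' : (toLex z : HahnField Λ R) * toLex z = b - a := hz
      rw [pow_two, hz', sub_add_cancel]
    set x : HahnSeries Λ R := ofLex b - ofLex a with hx
    have hx0 : 0 ≤ x.leadingCoeff := by
      have : (0 : HahnField Λ R) ≤ b - a := sub_nonneg.mpr hab
      exact HahnSeries.leadingCoeff_nonneg_iff.mpr this
    by_cases hne : x = 0
    · exact ⟨0, by simp [hne]⟩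
    obtain ⟨c, hc⟩ := IsRealClosed.nonneg_iff_isSquare.mp hx0
    have hlc : x.leadingCoeff ≠ 0 := HahnSeries.leadingCoeff_ne_zero.mpr hne
    set y : HahnSeries Λ R := HahnSeries.single (-x.order) (x.leadingCoeff)⁻¹ * x with hy
    have hyx : HahnSeries.single x.order x.leadingCoeff * y = x := by
      rw [hy, ← mul_assoc, HahnSeries.single_mul_single]
      simp [hlc]
    have hord : (x.order : WithTop Λ) = x.orderTop := HahnSeries.order_eq_orderTop_of_ne_zero hne
    have hy1 : 0 < (y - 1).orderTop := by
      rw [HahnSeries.orderTop_self_sub_one_pos_iff]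
      constructor
      · rw [hy, HahnSeries.orderTop_mul, HahnSeries.orderTop_single (inv_ne_zero hlc), ← hord,
          ← WithTop.coe_add, neg_add_cancel, WithTop.coe_zero]
      · rw [hy, HahnSeries.leadingCoeff_mul, HahnSeries.leadingCoeff_of_single,
          inv_mul_cancel₀ hlc]
    set s : HahnSeries Λ R := PowerSeries.heval (y - 1) (PowerSeries.binomialSeries R (1 / 2 : ℚ))
      with hs
    have hss : s * s = y := by
      rw [hs, ← map_mul, ← PowerSeries.binomialSeries_add, add_halves]
      have := PowerSeries.binomialSeries_nat (R := ℚ) (A := R) 1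
      rw [Nat.cast_one] at this
      rw [this, pow_one, map_add, map_one, PowerSeries.heval_X _ hy1]
      ring
    refine ⟨HahnSeries.single (DivisibleBy.div x.order 2) c * s, ?_⟩
    have h2 : DivisibleBy.div x.order 2 + DivisibleBy.div x.order 2 = x.order := by
      rw [← two_nsmul]
      exact DivisibleBy.div_cancel x.order two_ne_zero
    rw [mul_mul_mul_comm, HahnSeries.single_mul_single, hss, h2, ← hc, hyx]
  · rintro ⟨z, rfl⟩
    have := sq_nonneg z
    linarith

/-! (1) Nonnegative elements of `H` are squares, so a positive semidefinite matrix is a sum of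
matrices `v vᵀ` (`IsPosSemidefMatrix.exists_eq_sum_mul`), and one such matrix suffices. The entries
of `v` are `R`-combinations of at most `k` series with distinct orders
(`HahnSeries.exists_span_eq_injOn_order`). As `L_f` is `R`-linear, these series may replace `v`. The
lowest coefficient of the resulting form is then the matrix of `f` at sums of distinct orders,
evaluated at a nonzero vector over `R`; by definiteness it cannot cancel and is positive.

(2) The matrix `ε^(x i + x j)` has the form `v vᵀ`; testing its image on the vector `c i ε^(-x i)`
gives the form of `f` at `c` as a constant series. -/

/-! ### Leading terms whose coefficient may vanish. -/

/-- `x` has no terms of exponent less than `e`, and its coefficient at `e` is `c` (possibly `0`). -/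
def HahnSeries.HasLeadingTerm {Λ R : Type*} [LinearOrder Λ] [Zero R]
    (x : HahnSeries Λ R) (e : Λ) (c : R) : Prop :=
  (∀ g < e, x.coeff g = 0) ∧ x.coeff e = c

namespace HahnSeries.HasLeadingTerm

theorem sum {Λ R ι : Type*} [LinearOrder Λ] [AddCommMonoid R] {s : Finset ι}
    {x : ι → HahnSeries Λ R} {e : Λ} {c : ι → R} (h : ∀ i ∈ s, (x i).HasLeadingTerm e (c i)) :
    (∑ i ∈ s, x i).HasLeadingTerm e (∑ i ∈ s, c i) := by
  constructor
  · intro g hg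
    rw [HahnSeries.coeff_sum]
    exact Finset.sum_eq_zero fun i hi => (h i hi).1 g hg
  · rw [HahnSeries.coeff_sum]
    exact Finset.sum_congr rfl fun i hi => (h i hi).2

theorem mul {Λ R : Type*} [AddCommGroup Λ] [LinearOrder Λ] [IsOrderedAddMonoid Λ]
    [Semiring R] {x y : HahnSeries Λ R} {a b : Λ} {c d : R}
    (hx : x.HasLeadingTerm a c) (hy : y.HasLeadingTerm b d) :
    (x * y).HasLeadingTerm (a + b) (c * d) := by
  have hxa : ∀ g, x.coeff g ≠ 0 → a ≤ g := fun g h => not_lt.1 fun hg => h (hx.1 g hg)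
  have hyb : ∀ g, y.coeff g ≠ 0 → b ≤ g := fun g h => not_lt.1 fun hg => h (hy.1 g hg)
  constructor
  · intro g hg
    rw [HahnSeries.coeff_mul]
    refine Finset.sum_eq_zero fun p hp => ?_
    rw [Finset.mem_antidiagonal] at hp
    exact absurd (add_le_add (hxa _ hp.1) (hyb _ hp.2.1)) (by rw [hp.2.2]; exact hg.not_ge)
  · rw [HahnSeries.coeff_mul, Finset.sum_eq_single (a, b), hx.2, hy.2]
    · intro p hp hne
      rw [Finset.mem_antidiagonal] at hp
      exfalso
      have h1 := hxa _ hp.1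
      have h2 := hyb _ hp.2.1
      obtain ⟨h3, h4⟩ := (add_eq_add_iff_eq_and_eq h1 h2).1 hp.2.2.symm
      exact hne (Prod.ext h3.symm h4.symm)
    · intro h
      by_contra h0
      exact h (Finset.mem_antidiagonal.2
        ⟨fun h => h0 (by simp [h]), fun h => h0 (by simp [h]), rfl⟩)

/-- The bound is required only for `x ≠ 0`, because the order of the zero series is the default
value `0`. -/
theorem of_order {Λ R : Type*} [LinearOrder Λ] [Zero Λ] [Zero R] (x : HahnSeries Λ R) {e : Λ}
    (h : x ≠ 0 → e ≤ x.order) : x.HasLeadingTerm e (x.coeff e) := by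
  refine ⟨fun g hg => ?_, rfl⟩
  by_cases hx : x = 0
  · simp [hx]
  · exact HahnSeries.coeff_eq_zero_of_lt_order (hg.trans_le (h hx))

theorem toLex_pos {Λ R : Type*} [LinearOrder Λ] [Zero R] [LinearOrder R]
    {x : HahnSeries Λ R} {e : Λ} {c : R} (h : x.HasLeadingTerm e c) (hc : 0 < c) :
    (0 : Lex (HahnSeries Λ R)) < toLex x :=
  (HahnSeries.lt_iff _ _).2 ⟨e, fun j hj => (h.1 j hj).symm, by simpa [h.2] using hc⟩

end HahnSeries.HasLeadingTerm

/-! ### Linearity of `L_f`. -/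

/-- The map `L_f` as an `R`-linear map on Hahn series. -/
def hahnMultiplierLinear {Λ R : Type*} [LinearOrder Λ] [CommRing R] (f : Λ → R) :
    HahnSeries Λ R →ₗ[R] HahnSeries Λ R where
  toFun a := ofLex (hahnMultiplier f (toLex a))
  map_add' a b := by
    ext e
    simp [hahnMultiplier, mul_add]
  map_smul' c a := by
    ext e
    simp [hahnMultiplier, mul_left_comm]

theorem coeff_hahnMultiplierLinear {Λ R : Type*} [LinearOrder Λ] [CommRing R] (f : Λ → R)
    (a : HahnSeries Λ R) (e : Λ) :
    (hahnMultiplierLinear f a).coeff e = f e * a.coeff e := rfl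

theorem hahnMultiplierLinear_single {Λ R : Type*} [LinearOrder Λ] [CommRing R] (f : Λ → R)
    (e : Λ) (c : R) :
    hahnMultiplierLinear f (HahnSeries.single e c) = HahnSeries.single e (f e * c) := by
  ext g
  rw [coeff_hahnMultiplierLinear]
  by_cases h : g = e
  · simp [h]
  · simp [HahnSeries.coeff_single_of_ne h]

theorem HahnSeries.HasLeadingTerm.hahnMultiplierLinear {Λ R : Type*} [LinearOrder Λ]
    [CommRing R] (f : Λ → R) {x : HahnSeries Λ R} {e : Λ} {c : R} (h : x.HasLeadingTerm e c) :
    (hahnMultiplierLinear f x).HasLeadingTerm e (f e * c) :=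
  ⟨fun g hg => by rw [coeff_hahnMultiplierLinear, h.1 g hg, mul_zero],
    by rw [coeff_hahnMultiplierLinear, h.2]⟩

/-! ### Reduction to distinct orders, and positivity for `v vᵀ`. -/

/-- A finite-dimensional space of Hahn series is spanned by nonzero series of pairwise different
orders, at most as many as its dimension. -/
theorem HahnSeries.exists_span_eq_injOn_order {Λ R : Type*} [LinearOrder Λ] [Zero Λ] [Field R]
    (V : Submodule R (HahnSeries Λ R)) [FiniteDimensional R V] :
    ∃ T : Finset (HahnSeries Λ R), T.card ≤ Module.finrank R V ∧
      Submodule.span R (T : Set (HahnSeries Λ R)) = V ∧ (∀ x ∈ T, x ≠ 0) ∧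
      Set.InjOn HahnSeries.order (T : Set (HahnSeries Λ R)) := by
  classical
  induction hn : Module.finrank R V using Nat.strong_induction_on generalizing V with
  | _ n ih =>
  by_cases hV : V = ⊥
  · exact ⟨∅, by simp [hV]⟩
  obtain ⟨x, hxV, hx⟩ := Submodule.exists_mem_ne_zero_of_ne_bot hV
  have hxe : x.coeff x.order ≠ 0 := HahnSeries.coeff_order_eq_zero.ne.2 hx
  -- Killing the coefficient at `x.order` lowers the dimension and prevents this order from
  -- occurring again among nonzero elements of `W`.
  set W : Submodule R (HahnSeries Λ R) :=
    V ⊓ LinearMap.ker (HahnSeries.coeff.linearMap (R := R) (V := R) x.order) with hW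
  have hmemW : ∀ y, y ∈ W ↔ y ∈ V ∧ y.coeff x.order = 0 := fun y => by
    rw [hW, Submodule.mem_inf, LinearMap.mem_ker]; rfl
  have hlt : W < V := lt_of_le_of_ne inf_le_left fun h => hxe ((hmemW x).1 (h ▸ hxV)).2
  have hfin : Module.finrank R W < Module.finrank R V := Submodule.finrank_lt_finrank_of_lt hlt
  have : FiniteDimensional R W := Submodule.finiteDimensional_of_le hlt.le
  obtain ⟨T, hcard, hspan, hne, hinj⟩ := ih _ (hn ▸ hfin) W rfl
  have hTW : ∀ y ∈ T, y ∈ W := fun y hy => hspan ▸ Submodule.subset_span hy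
  refine ⟨insert x T, ?_, ?_, ?_, ?_⟩
  · exact (Finset.card_insert_le x T).trans (by omega)
  · rw [Finset.coe_insert, Submodule.span_insert, hspan]
    refine le_antisymm (sup_le ((Submodule.span_singleton_le_iff_mem x V).2 hxV) hlt.le) ?_
    intro y hy
    rw [Submodule.mem_sup]
    refine ⟨(y.coeff x.order / x.coeff x.order) • x,
      Submodule.smul_mem _ _ (Submodule.mem_span_singleton_self x),
      y - (y.coeff x.order / x.coeff x.order) • x, (hmemW _).2 ⟨?_, ?_⟩, by abel⟩
    · exact V.sub_mem hy (V.smul_mem _ hxV)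
    · simp [hxe]
  · intro y hy
    rcases Finset.mem_insert.1 hy with rfl | hy
    · exact hx
    · exact hne y hy
  · rw [Finset.coe_insert, Set.injOn_insert]
    · refine ⟨hinj, ?_⟩
      rintro ⟨y, hy, hyx⟩
      exact HahnSeries.coeff_order_eq_zero.ne.2 (hne y hy) (hyx ▸ ((hmemW y).1 (hTW y hy)).2)
    · exact fun h => hxe ((hmemW x).1 (hTW x h)).2

/-- A `k`-positive definite function gives positive definite forms on at most `k` points, as long
as these points can be completed to `k` different points. -/
theorem IsKPosDefFun.sum_pos {Λ R ι : Type*} [AddCommGroup Λ] [LinearOrder Λ]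
    [IsOrderedAddMonoid Λ] [CommRing R] [LinearOrder R] [Fintype ι]
    {k : ℕ} {f : Λ → R} (hf : IsKPosDefFun k f) (hΛ : Nontrivial Λ ∨ k ≤ 1)
    (hι : Fintype.card ι ≤ k) {e : ι → Λ} (he : Function.Injective e) {c : ι → R} (hc : c ≠ 0) :
    0 < ∑ i, ∑ j, c i * f (e i + e j) * c j := by
  classical
  have hS : ∃ S : Finset Λ, Finset.univ.image e ⊆ S ∧ S.card = k := by
    have hcard : (Finset.univ.image e).card = Fintype.card ι := by
      rw [Finset.card_image_of_injective _ he, Finset.card_univ]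
    -- A nontrivial ordered group is infinite, so padding points exist. If `k ≤ 1`, then `c ≠ 0`
    -- forces `ι` to have exactly `k` elements and no padding is needed.
    rcases hΛ with hΛ | hk
    · have : Infinite Λ := by
        obtain ⟨a, ha⟩ := exists_zero_lt (α := Λ)
        exact Infinite.of_injective (fun n : ℕ => n • a) (nsmul_left_strictMono ha).injective
      exact Infinite.exists_superset_card_eq _ _ (hcard ▸ hι)
    · obtain ⟨i, -⟩ := Function.ne_iff.1 hc
      have : 0 < Fintype.card ι := Fintype.card_pos_iff.2 ⟨i⟩
      exact ⟨_, subset_rfl, by omega⟩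
  obtain ⟨S, heS, hSk⟩ := hS
  let φ : S ≃ Fin k := S.equivFinOfCardEq hSk
  let g : ι → Fin k := fun i => φ ⟨e i, heS (Finset.mem_image_of_mem e (Finset.mem_univ i))⟩
  let x : Fin k → Λ := fun l => (φ.symm l : Λ)
  have hxg : ∀ i, x (g i) = e i := fun i => by simp [x, g]
  have hg : Function.Injective g := fun i j h => he (by rw [← hxg, h, hxg])
  have hx : Function.Injective x := Subtype.val_injective.comp φ.symm.injective
  -- The vector `c` is extended by zero to the padding points.
  have key := (hf x hx).2 (Function.extend g c (0 : Fin k → R)) (by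
    obtain ⟨i, hi⟩ := Function.ne_iff.1 hc
    exact fun h => hi (by rw [← hg.extend_apply c (0 : Fin k → R) i, h]; rfl))
  rw [← Matrix.toBilin'_apply', Matrix.toBilin'_apply] at key
  have h0 : ∀ l, l ∉ Set.range g → Function.extend g c (0 : Fin k → R) l = 0 := fun l hl =>
    Function.extend_apply' c (0 : Fin k → R) l hl
  convert key using 1
  refine Fintype.sum_of_injective g hg _ _ (fun l hl => by simp [h0 l hl]) fun i => ?_
  refine Fintype.sum_of_injective g hg _ _ (fun l hl => by simp [h0 l hl]) fun j => ?_
  simp [hg.extend_apply, hxg]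

/-- If `f` is positive definite on the orders of the nonzero series `b i`, then the matrix of the
`L_f (b i * b j)` is positive semidefinite. -/
theorem hahnMultiplierLinear_mul_sum_nonneg {Λ R ι : Type*} [AddCommGroup Λ] [LinearOrder Λ]
    [IsOrderedAddMonoid Λ] [Field R] [LinearOrder R] [IsStrictOrderedRing R] [Fintype ι]
    {f : Λ → R} {b : ι → HahnSeries Λ R} (hb : ∀ i, b i ≠ 0)
    (hf : ∀ c : ι → R, c ≠ 0 → 0 < ∑ i, ∑ j, c i * f ((b i).order + (b j).order) * c j)
    (w : ι → HahnSeries Λ R) :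
    (0 : HahnField Λ R) ≤
      toLex (∑ i, ∑ j, w i * hahnMultiplierLinear f (b i * b j) * w j) := by
  classical
  by_cases hw : w = 0
  · simp [hw]
  obtain ⟨i₀, hi₀⟩ := Function.ne_iff.1 hw
  obtain ⟨i, hi, hmin⟩ := Finset.exists_min_image (Finset.univ.filter fun i => w i ≠ 0)
    (fun i => (w i).order + (b i).order) ⟨i₀, by simpa using hi₀⟩
  have hwi : w i ≠ 0 := by simpa using hi
  set m := (w i).order + (b i).order with hm
  -- By minimality of `m`, no `w j * b j` has terms below `m`. Indices not attaining `m` just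
  -- contribute the coefficient `0`, so all indices are treated alike.
  have hwt : ∀ j, (w j).HasLeadingTerm (m - (b j).order) ((w j).coeff (m - (b j).order)) :=
    fun j => .of_order _ fun hj => sub_le_iff_le_add.2 (hmin j (by simpa using hj))
  have hbt : ∀ j, (b j).HasLeadingTerm (b j).order ((b j).coeff (b j).order) :=
    fun j => .of_order _ fun _ => le_rfl
  have hsum : (∑ i, ∑ j, w i * hahnMultiplierLinear f (b i * b j) * w j).HasLeadingTerm (m + m)
      (∑ i, ∑ j, ((w i).coeff (m - (b i).order) * (b i).coeff (b i).order) *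
        f ((b i).order + (b j).order) *
        ((w j).coeff (m - (b j).order) * (b j).coeff (b j).order)) := by
    refine .sum fun i _ => .sum fun j _ => ?_
    have h := ((hwt i).mul (((hbt i).mul (hbt j)).hahnMultiplierLinear f)).mul (hwt j)
    have he : m - (b i).order + ((b i).order + (b j).order) + (m - (b j).order) = m + m := by
      abel
    rw [he] at h
    exact ⟨h.1, h.2.trans (by ring)⟩
  refine (hsum.toLex_pos (hf _ ?_)).le
  -- The index attaining the minimum gives a nonzero coordinate.
  refine Function.ne_iff.2 ⟨i, ?_⟩
  rw [hm, add_sub_cancel_right]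
  exact mul_ne_zero (HahnSeries.coeff_order_eq_zero.ne.2 hwi) (HahnSeries.coeff_order_eq_zero.ne.2 (hb i))

/-- The orders of the `v i` may coincide, so definiteness of `f` does not apply to them directly.
Writing `v = p T` with `p` over `R` and distinct orders in `T` moves the form from `x` to `pᵀ x`. -/
theorem IsKPosDefFun.hahnMultiplierLinear_mul_sum_nonneg {Λ R : Type*} [AddCommGroup Λ]
    [LinearOrder Λ] [IsOrderedAddMonoid Λ] [Field R] [LinearOrder R] [IsStrictOrderedRing R]
    {k : ℕ} {f : Λ → R} (hf : IsKPosDefFun k f) (hΛ : Nontrivial Λ ∨ k ≤ 1)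
    (v x : Fin k → HahnSeries Λ R) :
    (0 : HahnField Λ R) ≤
      toLex (∑ i, ∑ j, x i * hahnMultiplierLinear f (v i * v j) * x j) := by
  classical
  have : FiniteDimensional R (Submodule.span R (Set.range v)) :=
    FiniteDimensional.span_of_finite R (Set.finite_range v)
  obtain ⟨T, hcard, hspan, hne, hinj⟩ :=
    HahnSeries.exists_span_eq_injOn_order (Submodule.span R (Set.range v))
  have hTk : Fintype.card T ≤ k := by
    rw [Fintype.card_coe]
    exact hcard.trans ((finrank_range_le_card v).trans (by simp))
  have hv : ∀ i, ∃ p : T → R, ∑ t, p t • (t : HahnSeries Λ R) = v i := fun i => by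
    have hi : v i ∈ Submodule.span R (T : Set (HahnSeries Λ R)) :=
      hspan ▸ Submodule.subset_span (Set.mem_range_self i)
    rw [← Subtype.range_coe (s := (T : Set (HahnSeries Λ R)))] at hi
    exact Submodule.mem_span_range_iff_exists_fun R |>.1 hi
  choose p hp using hv
  have key := _root_.hahnMultiplierLinear_mul_sum_nonneg (f := f) (ι := T) (b := fun t => t)
    (fun t => hne t t.2)
    (fun c hc => hf.sum_pos hΛ hTk (fun s t h => Subtype.ext (hinj s.2 t.2 h)) hc)
    (fun t => ∑ i, p i t • x i)
  convert key using 2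
  have hL : ∀ i j, hahnMultiplierLinear f (v i * v j) =
      ∑ s, ∑ t, (p i s * p j t) • hahnMultiplierLinear f ((s : HahnSeries Λ R) * t) := by
    intro i j
    rw [← hp i, ← hp j, Finset.sum_mul_sum]
    simp only [map_sum, smul_mul_smul_comm, map_smul]
  simp only [hL, Finset.sum_mul, Finset.mul_sum, ← Fintype.sum_prod_type']
  -- The equivalence only permutes the four summation indices.
  refine Fintype.sum_equiv ⟨fun q => (q.2.2.1, q.2.2.2, q.2.1, q.1),
    fun q => (q.2.2.2, q.2.2.1, q.1, q.2.1), fun _ => rfl, fun _ => rfl⟩ _ _ fun q => ?_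
  simp only [Equiv.coe_fn_mk, smul_mul_assoc, mul_smul_comm, smul_smul, mul_comm]

/-! ### Decomposition of positive semidefinite matrices, and the theorem. -/

/-- Over an ordered field whose nonnegative elements are squares, a positive semidefinite matrix
is a sum of matrices of the form `v vᵀ`. -/
theorem IsPosSemidefMatrix.exists_eq_sum_mul {n K : Type*} [Fintype n] [Field K] [LinearOrder K]
    [IsStrictOrderedRing K] (hK : ∀ a : K, 0 ≤ a → IsSquare a) {A : Matrix n n K}
    (hA : IsPosSemidefMatrix A) :
    ∃ (m : ℕ) (v : Fin m → n → K), ∀ i j, A i j = ∑ l, v l i * v l j := by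
  classical
  have : Invertible (2 : K) := invertibleOfNonzero two_ne_zero
  obtain ⟨b, hb⟩ := LinearMap.BilinForm.exists_orthogonal_basis
    (B := Matrix.toBilin' A)
    ⟨(Matrix.isSymm_toBilin'_iff_isSymm.2 hA.1).eq⟩
  have hd : ∀ l, ∃ d : K, Matrix.toBilin' A (b l) (b l) = d * d := fun l =>
    hK _ (by rw [Matrix.toBilin'_apply']; exact hA.2 _)
  choose d hd using hd
  -- Expanding the standard vectors in the orthogonal basis leaves only the diagonal values `d l * d
  -- l`.
  refine ⟨_, fun l i => d l * b.repr (Pi.single i 1) l, fun i j => ?_⟩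
  rw [← Matrix.toBilin'_single A i j]
  conv_lhs => rw [← b.sum_repr (Pi.single i 1), ← b.sum_repr (Pi.single j 1)]
  simp only [map_sum, map_smul, LinearMap.sum_apply, LinearMap.smul_apply, smul_eq_mul]
  refine Finset.sum_congr rfl fun l _ => ?_
  rw [Finset.sum_eq_single l]
  · rw [hd]; ring
  · intro l' _ hl
    have : Matrix.toBilin' A (b l') (b l) = 0 := hb hl
    simp [this]
  · simp

theorem mainTheorem5 {Λ R : Type*}
    [AddCommGroup Λ] [LinearOrder Λ] [IsOrderedAddMonoid Λ] [DivisibleBy Λ ℕ]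
    [Field R] [LinearOrder R] [IsStrictOrderedRing R] [IsRealClosed R] [Algebra ℝ R]
    (k : ℕ) (f : Λ → R) :
    (Nontrivial Λ ∨ k ≤ 1 → IsKPosDefFun k f → IsKPositive k (hahnMultiplier f)) ∧
    (IsKPositive k (hahnMultiplier f) → IsKPosSemidefFun k f) := by
  constructor
  · intro hΛ hf A hA
    refine ⟨?_, fun x => ?_⟩
    · ext i j
      simp only [Matrix.transpose_apply, Matrix.map_apply, hA.1.apply]
    · have hsq : ∀ a : HahnField Λ R, 0 ≤ a → IsSquare a := fun a ha => by
        obtain ⟨z, hz⟩ := (HahnField.le_iff_exists_sq_add 0 a).1 ha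
        exact ⟨z, by rw [← hz, add_zero, sq]⟩
      obtain ⟨m, v, hv⟩ := hA.exists_eq_sum_mul hsq
      have hL : ∀ i j, A.map (hahnMultiplier f) i j =
          ∑ l, toLex (hahnMultiplierLinear f (ofLex (v l i) * ofLex (v l j))) := by
        intro i j
        have : A.map (hahnMultiplier f) i j = toLex (hahnMultiplierLinear f (A i j)) := rfl
        rw [this, hv]
        exact map_sum (hahnMultiplierLinear f) (fun l => v l i * v l j) _
      rw [← Matrix.toBilin'_apply', Matrix.toBilin'_apply]
      have : ∑ i, ∑ j, x i * A.map (hahnMultiplier f) i j * x j =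
          ∑ l, ∑ i, ∑ j, x i *
            toLex (hahnMultiplierLinear f (ofLex (v l i) * ofLex (v l j))) * x j := by
        simp only [hL, Finset.mul_sum, Finset.sum_mul]
        rw [Finset.sum_congr rfl fun i _ => Finset.sum_comm, Finset.sum_comm]
      rw [this]
      exact Finset.sum_nonneg fun l _ => hf.hahnMultiplierLinear_mul_sum_nonneg hΛ (v l) x
  · intro hL x
    let ε : Λ → HahnField Λ R := fun e => toLex (HahnSeries.single e 1)
    have hε : ∀ a b, ε a * ε b = ε (a + b) := fun a b => by
      have h := HahnSeries.single_mul_single (a := a) (b := b) (r := (1 : R)) (s := 1)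
      rw [mul_one] at h
      exact congrArg toLex h
    have hA : IsPosSemidefMatrix (Matrix.of fun i j => ε (x i + x j)) := by
      refine ⟨by ext i j; simp [add_comm], fun y => ?_⟩
      rw [← Matrix.toBilin'_apply', Matrix.toBilin'_apply]
      have : ∑ i, ∑ j, y i * Matrix.of (fun i j => ε (x i + x j)) i j * y j =
          (∑ i, y i * ε (x i)) * ∑ j, y j * ε (x j) := by
        rw [Finset.sum_mul_sum]
        refine Finset.sum_congr rfl fun i _ => Finset.sum_congr rfl fun j _ => ?_
        rw [Matrix.of_apply, ← hε]; ring
      rw [this]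
      exact mul_self_nonneg _
    refine ⟨by ext i j; simp [add_comm], fun c => ?_⟩
    -- The exponents `-x i` and `-x j` cancel `x i + x j`, so every term has exponent `0`.
    have key := (hL _ hA).2 fun i => toLex (HahnSeries.single (-x i) (c i))
    rw [← Matrix.toBilin'_apply', Matrix.toBilin'_apply] at key ⊢
    have hsum : ∑ i, ∑ j, toLex (HahnSeries.single (-x i) (c i)) *
        (Matrix.of fun i j => ε (x i + x j)).map (hahnMultiplier f) i j *
        toLex (HahnSeries.single (-x j) (c j)) =
        toLex (HahnSeries.single (0 : Λ)
          (∑ i, ∑ j, c i * Matrix.of (fun i j => f (x i + x j)) i j * c j)) := by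
      have hterm : ∀ i j, HahnSeries.single (-x i) (c i) *
          hahnMultiplierLinear f (HahnSeries.single (x i + x j) 1) *
          HahnSeries.single (-x j) (c j) =
          HahnSeries.single (0 : Λ) (c i * f (x i + x j) * c j) := by
        intro i j
        rw [hahnMultiplierLinear_single, HahnSeries.single_mul_single,
          HahnSeries.single_mul_single, mul_one]
        rw [show -x i + (x i + x j) + -x j = 0 by abel]
      have h : ∑ i, ∑ j, HahnSeries.single (-x i) (c i) *
          hahnMultiplierLinear f (HahnSeries.single (x i + x j) 1) *
          HahnSeries.single (-x j) (c j) =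
          HahnSeries.single (0 : Λ) (∑ i, ∑ j, c i * f (x i + x j) * c j) := by
        simp only [hterm, ← HahnSeries.C_apply, map_sum]
      exact congrArg toLex h
    rw [hsum, ← HahnSeries.leadingCoeff_nonneg_iff, ofLex_toLex,
      HahnSeries.leadingCoeff_of_single] at key
    exact key
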